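/- For positive integers $a_1<\dots<a_n$ put $$M(a_1,\dots,a_n)=\max_{|z|=1}\prod_{j=1}^n|1-z^{a_j}|.$$ There is an absolute constant $c>0$ with the following property. For every $\varepsilon>0$ there is $N_0=N_0(\varepsilon)$ such that for every integer $N\ge N_0$ there is a subset $\{a_1<\dots<a_n\}\subset\{1,\dots,N\}$ with $$\Bigl|n-\frac N2\Bigr|\le\varepsilon N \qquad\text{and}\qquad M(a_1,\dots,a_n)<\exp\bigl(c\,\sqrt n\,\sqrt{\log n}\,\log\log n\bigr).$$ -/

import Mathlib

/-- The maximum of `∏ᵢ |1 - z ^ (a i)|` over the unit circle `|z| = 1`, for a finite sequence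
`a` of natural numbers. It is written as a supremum; the lemma below shows that it is attained. -/
noncomputable def circleMax {n : ℕ} (a : Fin n → ℕ) : ℝ :=
  ⨆ z : Circle, ∏ i, ‖1 - (z : ℂ) ^ a i‖

/-- The supremum defining `circleMax` is a maximum. -/
theorem isGreatest_circleMax {n : ℕ} (a : Fin n → ℕ) :
    IsGreatest (Set.range fun z : Circle => ∏ i, ‖1 - (z : ℂ) ^ a i‖) (circleMax a) := by
  have hc : Continuous fun z : Circle => ∏ i, ‖1 - (z : ℂ) ^ a i‖ := by fun_prop
  exact (isCompact_range hc).isGreatest_sSup (Set.range_nonempty _)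

/-!
Let `S` be the random subset of `{1, …, N}` that contains `j` with probability `1 - j / N`,
independently. Its size has mean `(N - 1) / 2` and fluctuates by `O(√N)`. For `|z| = 1` and
`0 < t ≤ 2`,

  `E ∏ j ∈ S, |1 - z ^ j| ^ t ≤ exp (∑ j, (1 - j / N) * (|1 - z ^ j| ^ t - 1))`.

The weights `1 - j / N` are those of the Fejér kernel, which is nonnegative. On the other hand all the
Fourier coefficients of `|1 - w| ^ t` on the circle except the constant one are nonpositive: this
function is the square of the modulus of `(1 - w) ^ (t / 2) = 1 - ∑ b k * w ^ (k + 1)`, where `b` is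
nonnegative, antitone and of total mass at most `1`. So every nonconstant frequency contributes at most
`0` to the full sum over differences (`sum_norm_sq_one_sub_sum_le`), and as the constant coefficient
is `1 + ∑ b k ^ 2 = 1 + O(t ^ 2)`, the exponent above is at most `N * t ^ 2 / 4 + 1 / 2`
(`sum_weight_mul_norm_one_sub_pow_le`).

A polynomial of degree at most `N ^ 2` is controlled on the circle by its values at the roots of unity
of order `N ^ 2 + 1`, up to the factor `N ^ 2 + 1` (`norm_eval_le_of_forall_root_of_unity`). Hence it
suffices to average the sum of the `t`-th powers of the products at these points, along with two
exponential moments of the size of `S` (`exists_subset_prod_norm_one_sub_pow_le`). The resulting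
bound is `exp (O(log N / t + N * t))`, and `t = √(log N / N)` gives `exp (O(√(N * log N)))`, which is
stronger than required by the factor `log (log n)` in the exponent.
-/

/-! ### Double sums -/

open Finset in
theorem sum_range_sum_range_of_symm (g : ℕ → ℕ → ℝ) (hg : ∀ k l, g k l = g l k) (K : ℕ) :
    ∑ k ∈ range K, ∑ l ∈ range K, g k l
      = ∑ k ∈ range K, g k k + 2 * ∑ k ∈ range K, ∑ l ∈ range k, g k l := by
  induction K with
  | zero => simp
  | succ K ih =>
    simp only [sum_range_succ, sum_add_distrib, ih]
    rw [sum_congr rfl fun k _ => hg k K]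
    ring

open Finset in
theorem sum_range_sum_range_conv_le (c b : ℕ → ℝ) (hc : ∀ k, 0 ≤ c k) (hb : ∀ k, 0 ≤ b k) (K : ℕ) :
    ∑ k ∈ range K, ∑ l ∈ range k, c (k - (l + 1)) * b l
      ≤ (∑ k ∈ range K, c k) * ∑ l ∈ range K, b l := by
  have h : ∑ k ∈ range K, ∑ l ∈ range k, c (k - (l + 1)) * b l
      = ∑ l ∈ range K, ∑ k ∈ Ico (l + 1) K, c (k - (l + 1)) * b l := by
    refine sum_comm' fun x y => ?_
    simp only [mem_range, mem_Ico]
    omega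
  rw [h, mul_sum]
  refine sum_le_sum fun l _ => ?_
  rw [← sum_mul, sum_Ico_eq_sum_range]
  refine mul_le_mul_of_nonneg_right ?_ (hb l)
  simp only [Nat.add_sub_cancel_left]
  exact sum_le_sum_of_subset_of_nonneg (range_mono (Nat.sub_le _ _)) fun _ _ _ => hc _

/-! ### Power series with antitone coefficients and Fejér positivity -/

open Finset ComplexConjugate in
/-- `|1 - ∑ b k w ^ (k + 1)| ^ 2` multiplied out, for real `b`. -/
theorem norm_sq_one_sub_sum (b : ℕ → ℝ) (K : ℕ) (w : ℂ) :
    ‖1 - ∑ k ∈ range K, (b k : ℂ) * w ^ (k + 1)‖ ^ 2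
      = 1 - 2 * ∑ k ∈ range K, b k * (w ^ (k + 1)).re
        + ∑ k ∈ range K, ∑ l ∈ range K, b k * b l * (w ^ (k + 1) * conj w ^ (l + 1)).re := by
  have h : (((‖1 - ∑ k ∈ range K, (b k : ℂ) * w ^ (k + 1)‖ ^ 2 : ℝ) : ℂ)).re =
      ((1 - ∑ k ∈ range K, (b k : ℂ) * w ^ (k + 1)) *
        conj (1 - ∑ k ∈ range K, (b k : ℂ) * w ^ (k + 1))).re := by
    rw [Complex.mul_conj']; norm_cast
  rw [Complex.ofReal_re] at h
  rw [h]
  have e : ∀ A : ℂ, ((1 - A) * conj (1 - A)).re = 1 - 2 * A.re + (A * conj A).re := by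
    intro A
    simp [Complex.mul_re]; ring
  rw [e, map_sum, sum_mul_sum, Complex.re_sum, Complex.re_sum]
  simp only [Complex.re_sum, map_mul, map_pow, Complex.conj_ofReal, Complex.re_ofReal_mul]
  congr 1
  refine sum_congr rfl fun k _ => sum_congr rfl fun l _ => ?_
  rw [← Complex.re_ofReal_mul]
  congr 1
  push_cast
  ring

open Finset ComplexConjugate in
/-- The Fejér kernel is nonnegative, for arbitrary points `u i` in place of the powers of one
point: the sum over all differences is the square of a modulus. -/
theorem sum_sum_re_eq_norm_sq {ι : Type*} (s : Finset ι) (u : ι → ℂ) (k l : ℕ) :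
    ∑ i ∈ s, ∑ j ∈ s, ((u i * conj (u j)) ^ k * conj (u i * conj (u j)) ^ l).re
      = ‖∑ i ∈ s, u i ^ k * conj (u i) ^ l‖ ^ 2 := by
  have h : (((‖∑ i ∈ s, u i ^ k * conj (u i) ^ l‖ ^ 2 : ℝ) : ℂ)).re =
      ((∑ i ∈ s, u i ^ k * conj (u i) ^ l) * conj (∑ i ∈ s, u i ^ k * conj (u i) ^ l)).re := by
    rw [Complex.mul_conj']; norm_cast
  rw [Complex.ofReal_re] at h
  rw [h, map_sum, sum_mul_sum]
  simp only [Complex.re_sum]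
  refine sum_congr rfl fun i _ => sum_congr rfl fun j _ => ?_
  congr 1
  simp only [map_mul, map_pow, Complex.conj_conj]
  ring

open Finset ComplexConjugate in
/-- For unit complex numbers `u i`, the sum of `|1 - ∑ b k w ^ (k + 1)| ^ 2` over all the quotients
`w = u i / u j` is at most what the constant Fourier coefficient alone contributes. Indeed the
coefficient of `w ^ m` with `m ≥ 1` is `-b (m - 1) + ∑ l, b l * b (l + m)`, which is `≤ 0` because
`b` is antitone of total mass at most `1`, and the sum of `w ^ m` over the quotients is `≥ 0`. -/
theorem sum_norm_sq_one_sub_sum_le {ι : Type*} (s : Finset ι) (u : ι → ℂ)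
    (hu : ∀ i ∈ s, ‖u i‖ = 1) (b : ℕ → ℝ) (hb : ∀ k, 0 ≤ b k) (hanti : Antitone b) (K : ℕ)
    (hsum : ∑ k ∈ range K, b k ≤ 1) :
    ∑ i ∈ s, ∑ j ∈ s, ‖1 - ∑ k ∈ range K, (b k : ℂ) * (u i * conj (u j)) ^ (k + 1)‖ ^ 2
      ≤ (s.card : ℝ) ^ 2 * (1 + ∑ k ∈ range K, b k ^ 2) := by
  set H : ℕ → ℝ := fun m => ‖∑ i ∈ s, u i ^ m‖ ^ 2 with hH
  set h : ℕ → ℕ → ℝ := fun k l => ‖∑ i ∈ s, u i ^ k * conj (u i) ^ l‖ ^ 2 with hh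
  have hH0 : ∀ m, 0 ≤ H m := fun m => by positivity
  have hsymm : ∀ k l, h k l = h l k := by
    intro k l
    simp only [hh]
    rw [← Complex.norm_conj, map_sum]
    congr 2
    refine sum_congr rfl fun i _ => ?_
    simp [mul_comm]
  have hunit : ∀ i ∈ s, u i * conj (u i) = 1 := by
    intro i hi
    rw [Complex.mul_conj', hu i hi]; simp
  have hhH : ∀ k l, l ≤ k → h k l = H (k - l) := by
    intro k l hkl
    simp only [hh, hH]
    congr 2
    refine sum_congr rfl fun i hi => ?_
    obtain ⟨m, rfl⟩ := Nat.exists_eq_add_of_le hkl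
    rw [Nat.add_sub_cancel_left, pow_add, mul_right_comm, ← mul_pow, hunit i hi, one_pow, one_mul]
  have hHz : H 0 = (s.card : ℝ) ^ 2 := by simp [hH]
  have hexp : ∑ i ∈ s, ∑ j ∈ s, ‖1 - ∑ k ∈ range K, (b k : ℂ) * (u i * conj (u j)) ^ (k + 1)‖ ^ 2
      = (s.card : ℝ) ^ 2 - 2 * ∑ k ∈ range K, b k * H (k + 1)
        + ∑ k ∈ range K, ∑ l ∈ range K, b k * b l * h (k + 1) (l + 1) := by
    simp only [norm_sq_one_sub_sum, sum_add_distrib, sum_sub_distrib]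
    congr 1
    · congr 1
      · simp [sq]
      · simp only [← mul_sum]
        congr 1
        have : ∀ k, H (k + 1) = ∑ i ∈ s, ∑ j ∈ s, ((u i * conj (u j)) ^ (k + 1)).re := by
          intro k
          have := sum_sum_re_eq_norm_sq s u (k + 1) 0
          simp only [pow_zero, mul_one] at this
          rw [this]
        simp only [this, mul_sum]
        rw [sum_congr rfl fun i _ => sum_comm, sum_comm]
    · simp only [hh, ← sum_sum_re_eq_norm_sq, mul_sum]
      rw [sum_congr rfl fun i _ => sum_comm, sum_comm]
      refine sum_congr rfl fun k _ => ?_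
      rw [sum_congr rfl fun i _ => sum_comm, sum_comm]
  have hoff : ∑ k ∈ range K, ∑ l ∈ range k, b k * b l * h (k + 1) (l + 1)
      ≤ ∑ k ∈ range K, b k * H (k + 1) := by
    calc ∑ k ∈ range K, ∑ l ∈ range k, b k * b l * h (k + 1) (l + 1)
        ≤ ∑ k ∈ range K, ∑ l ∈ range k,
            (b (k - (l + 1)) * H (k - (l + 1) + 1)) * b l := by
          refine sum_le_sum fun k _ => sum_le_sum fun l hl => ?_
          have hlk : l < k := mem_range.1 hl
          rw [hhH _ _ (by omega), show k + 1 - (l + 1) = k - (l + 1) + 1 by omega]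
          have h1 : b k ≤ b (k - (l + 1)) := hanti (Nat.sub_le _ _)
          have h2 := mul_le_mul_of_nonneg_right h1
            (mul_nonneg (hb l) (hH0 (k - (l + 1) + 1)))
          linarith
      _ ≤ (∑ k ∈ range K, b k * H (k + 1)) * ∑ l ∈ range K, b l :=
          sum_range_sum_range_conv_le (fun k => b k * H (k + 1)) b
            (fun k => mul_nonneg (hb k) (hH0 _)) hb K
      _ ≤ _ := mul_le_of_le_one_right
          (sum_nonneg fun k _ => mul_nonneg (hb k) (hH0 _)) hsum
  rw [hexp, sum_range_sum_range_of_symm (fun k l => b k * b l * h (k + 1) (l + 1))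
    (fun k l => by rw [hsymm, mul_comm (b k)])]
  have hdiag : ∑ k ∈ range K, b k * b k * h (k + 1) (k + 1)
      = (s.card : ℝ) ^ 2 * ∑ k ∈ range K, b k ^ 2 := by
    rw [mul_sum]
    refine sum_congr rfl fun k _ => ?_
    rw [hhH _ _ le_rfl, Nat.sub_self, hHz]; ring
  rw [hdiag]
  linarith

/-! ### The binomial series of `(1 - x) ^ s` for `0 ≤ s ≤ 1` -/

/-- The number `(-1) ^ k * (s choose (k + 1))`, so that
`(1 - x) ^ s = 1 - ∑ subPowCoeff s k * x ^ (k + 1)` for `|x| < 1`. The index is shifted because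
the constant term is split off, and the product form makes signs and monotonicity visible. -/
noncomputable def subPowCoeff (s : ℝ) (k : ℕ) : ℝ :=
  s / (k + 1) * ∏ i ∈ Finset.range k, (1 - s / (i + 1))

theorem subPowCoeff_succ (s : ℝ) (k : ℕ) :
    subPowCoeff s (k + 1) = subPowCoeff s k * ((k + 1 - s) / (k + 2)) := by
  simp only [subPowCoeff, Finset.prod_range_succ]
  push_cast
  field_simp
  ring

/-- The partial sums telescope, since `subPowCoeff s k` is the difference of the products over
`range k` and `range (k + 1)`. -/
theorem sum_subPowCoeff (s : ℝ) (K : ℕ) :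
    ∑ k ∈ Finset.range K, subPowCoeff s k = 1 - ∏ i ∈ Finset.range K, (1 - s / (i + 1)) := by
  induction K with
  | zero => simp
  | succ K ih =>
    rw [Finset.sum_range_succ, ih, Finset.prod_range_succ, subPowCoeff]
    ring

theorem one_sub_div_succ_nonneg {s : ℝ} (h1 : s ≤ 1) (i : ℕ) : 0 ≤ 1 - s / ((i : ℝ) + 1) := by
  rw [sub_nonneg, div_le_one (by positivity)]
  have : (0 : ℝ) ≤ i := by positivity
  linarith

theorem subPowCoeff_nonneg {s : ℝ} (h0 : 0 ≤ s) (h1 : s ≤ 1) (k : ℕ) : 0 ≤ subPowCoeff s k :=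
  mul_nonneg (by positivity) (Finset.prod_nonneg fun i _ => one_sub_div_succ_nonneg h1 i)

theorem subPowCoeff_antitone {s : ℝ} (h0 : 0 ≤ s) (h1 : s ≤ 1) : Antitone (subPowCoeff s) := by
  refine antitone_nat_of_succ_le fun k => ?_
  rw [subPowCoeff_succ]
  refine mul_le_of_le_one_right (subPowCoeff_nonneg h0 h1 k) ?_
  rw [div_le_one (by positivity)]
  linarith

theorem sum_subPowCoeff_le_one {s : ℝ} (h1 : s ≤ 1) (K : ℕ) :
    ∑ k ∈ Finset.range K, subPowCoeff s k ≤ 1 := by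
  rw [sum_subPowCoeff]
  linarith [Finset.prod_nonneg fun i (_ : i ∈ Finset.range K) => one_sub_div_succ_nonneg h1 i]

theorem subPowCoeff_le {s : ℝ} (h0 : 0 ≤ s) (h1 : s ≤ 1) (k : ℕ) :
    subPowCoeff s k ≤ s / (k + 1) :=
  mul_le_of_le_one_right (by positivity)
    (Finset.prod_le_one (fun i _ => one_sub_div_succ_nonneg h1 i) fun i _ => by
      have : 0 ≤ s / ((i : ℝ) + 1) := by positivity
      linarith)

theorem sum_one_div_succ_sq_le (K : ℕ) :
    ∑ k ∈ Finset.range K, (1 / ((k : ℝ) + 1)) ^ 2 ≤ 2 - 1 / (K : ℝ) := by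
  induction K with
  | zero => norm_num
  | succ K ih =>
    rcases Nat.eq_zero_or_pos K with rfl | hK
    · norm_num
    have hK' : (0 : ℝ) < K := by exact_mod_cast hK
    have h : (1 / ((K : ℝ) + 1)) ^ 2 ≤ 1 / K - 1 / (K + 1) := by
      rw [div_sub_div _ _ hK'.ne' (by positivity), div_pow, div_le_div_iff₀ (by positivity)
        (by positivity)]
      nlinarith
    rw [Finset.sum_range_succ]
    push_cast
    linarith

theorem sum_subPowCoeff_sq_le {s : ℝ} (h0 : 0 ≤ s) (h1 : s ≤ 1) (K : ℕ) :
    ∑ k ∈ Finset.range K, subPowCoeff s k ^ 2 ≤ 2 * s ^ 2 := by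
  calc ∑ k ∈ Finset.range K, subPowCoeff s k ^ 2
      ≤ ∑ k ∈ Finset.range K, s ^ 2 * (1 / ((k : ℝ) + 1)) ^ 2 := by
        refine Finset.sum_le_sum fun k _ => ?_
        rw [← mul_pow, mul_one_div]
        exact pow_le_pow_left₀ (subPowCoeff_nonneg h0 h1 k) (subPowCoeff_le h0 h1 k) 2
    _ = s ^ 2 * ∑ k ∈ Finset.range K, (1 / ((k : ℝ) + 1)) ^ 2 := by rw [Finset.mul_sum]
    _ ≤ s ^ 2 * 2 := by
        refine mul_le_mul_of_nonneg_left ((sum_one_div_succ_sq_le K).trans ?_) (sq_nonneg s)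
        have : (0 : ℝ) ≤ 1 / (K : ℝ) := by positivity
        linarith
    _ = _ := mul_comm _ _

theorem choose_succ_mul_neg_one_pow (s : ℝ) (k : ℕ) :
    Ring.choose (s : ℂ) (k + 1) * (-1) ^ (k + 1) = -(subPowCoeff s k : ℂ) := by
  have hrec : ∀ n : ℕ, Ring.choose (s : ℂ) (n + 1) = Ring.choose (s : ℂ) n * ((s - n) / (n + 1)) := by
    intro n
    rw [Ring.choose_eq_smul, Ring.choose_eq_smul, descPochhammer_succ_right, Polynomial.smeval_mul,
      Nat.factorial_succ]
    have : (n : ℂ) + 1 ≠ 0 := by exact_mod_cast n.succ_ne_zero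
    have h2 : (n.factorial : ℂ) ≠ 0 := by exact_mod_cast n.factorial_ne_zero
    simp [Polynomial.smeval_sub, Polynomial.smeval_natCast]
    field_simp
  induction k with
  | zero => simp [subPowCoeff]
  | succ k ih =>
    rw [hrec, subPowCoeff_succ, pow_succ,
      show Ring.choose (s : ℂ) (k + 1) * ((s - ((k + 1 : ℕ) : ℂ)) / (((k + 1 : ℕ) : ℂ) + 1)) *
        ((-1) ^ (k + 1) * -1) = (Ring.choose (s : ℂ) (k + 1) * (-1) ^ (k + 1)) *
          (-((s - ((k + 1 : ℕ) : ℂ)) / (((k + 1 : ℕ) : ℂ) + 1))) by ring, ih]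
    push_cast
    ring

open Filter Topology in
theorem tendsto_one_sub_sum_subPowCoeff (s : ℝ) {x : ℂ} (hx : ‖x‖ < 1) :
    Tendsto (fun K => 1 - ∑ k ∈ Finset.range K, (subPowCoeff s k : ℂ) * x ^ (k + 1)) atTop
      (𝓝 ((1 - x) ^ (s : ℂ))) := by
  have h := (Complex.one_add_cpow_hasFPowerSeriesOnBall_zero (a := (s : ℂ))).hasSum (y := -x)
    (by simpa [enorm_eq_nnnorm, ← NNReal.coe_lt_one] using hx)
  have h2 := (tendsto_add_atTop_iff_nat 1).2 h.tendsto_sum_nat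
  rw [zero_add, ← sub_eq_add_neg] at h2
  refine h2.congr fun K => ?_
  rw [Finset.sum_range_succ', sub_eq_add_neg, add_comm, ← Finset.sum_neg_distrib]
  simp only [binomialSeries_apply, List.ofFn_const, List.prod_replicate, smul_eq_mul]
  congr 1
  · simp
  · refine Finset.sum_congr rfl fun k _ => ?_
    rw [neg_pow, ← mul_assoc, choose_succ_mul_neg_one_pow, neg_mul]

/-! ### Fejér means of `|1 - z ^ j| ^ t` -/

open Finset ComplexConjugate Filter Topology in
/-- The case `|1 - w| ^ (2 * s)` of `sum_norm_sq_one_sub_sum_le`, obtained by truncating the binomial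
series of `(1 - r * w) ^ s` and then letting the radius `r < 1` tend to `1`. -/
theorem sum_norm_one_sub_rpow_le {ι : Type*} (S : Finset ι) (u : ι → ℂ)
    (hu : ∀ i ∈ S, ‖u i‖ = 1) {s : ℝ} (h0 : 0 < s) (h1 : s ≤ 1) :
    ∑ i ∈ S, ∑ j ∈ S, ‖1 - u i * conj (u j)‖ ^ (2 * s) ≤ (S.card : ℝ) ^ 2 * (1 + 2 * s ^ 2) := by
  have key : ∀ r : ℝ, 0 ≤ r → r < 1 →
      ∑ i ∈ S, ∑ j ∈ S, ‖1 - r * (u i * conj (u j))‖ ^ (2 * s)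
        ≤ (S.card : ℝ) ^ 2 * (1 + 2 * s ^ 2) := by
    intro r hr0 hr1
    have hlim : Tendsto (fun K => ∑ i ∈ S, ∑ j ∈ S,
        ‖1 - ∑ k ∈ range K, (subPowCoeff s k : ℂ) * (r * (u i * conj (u j))) ^ (k + 1)‖ ^ 2) atTop
        (𝓝 (∑ i ∈ S, ∑ j ∈ S, ‖1 - r * (u i * conj (u j))‖ ^ (2 * s))) := by
      refine tendsto_finsetSum _ fun i hi => tendsto_finsetSum _ fun j hj => ?_
      have hx : ‖(r : ℂ) * (u i * conj (u j))‖ < 1 := by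
        simp [hu i hi, hu j hj, abs_of_nonneg hr0, hr1]
      have := ((tendsto_one_sub_sum_subPowCoeff s hx).norm).pow 2
      rwa [Complex.norm_cpow_real, ← Real.rpow_natCast, ← Real.rpow_mul (norm_nonneg _),
        mul_comm s] at this
    refine le_of_tendsto' hlim fun K => ?_
    set b : ℕ → ℝ := fun k => subPowCoeff s k * r ^ (k + 1) with hb
    have hr : ∀ k : ℕ, r ^ (k + 1) ≤ 1 := fun k => pow_le_one₀ hr0 hr1.le
    have hbs : ∀ k, b k ≤ subPowCoeff s k := fun k =>
      mul_le_of_le_one_right (subPowCoeff_nonneg h0.le h1 k) (hr k)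
    have hb0 : ∀ k, 0 ≤ b k := fun k =>
      mul_nonneg (subPowCoeff_nonneg h0.le h1 k) (pow_nonneg hr0 _)
    have hanti : Antitone b := fun k l hkl =>
      mul_le_mul (subPowCoeff_antitone h0.le h1 hkl)
        (pow_le_pow_of_le_one hr0 hr1.le (by omega)) (pow_nonneg hr0 _)
        (subPowCoeff_nonneg h0.le h1 k)
    have := sum_norm_sq_one_sub_sum_le S u hu b hb0 hanti K
      ((sum_le_sum fun k _ => hbs k).trans (sum_subPowCoeff_le_one h1 K))
    have hsq : ∑ k ∈ range K, b k ^ 2 ≤ 2 * s ^ 2 :=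
      (sum_le_sum fun k _ => pow_le_pow_left₀ (hb0 k) (hbs k) 2).trans
        (sum_subPowCoeff_sq_le h0.le h1 K)
    refine le_trans (le_of_eq ?_) (this.trans
      (mul_le_mul_of_nonneg_left (by linarith) (sq_nonneg _)))
    refine sum_congr rfl fun i _ => sum_congr rfl fun j _ => ?_
    congr 3
    refine sum_congr rfl fun k _ => ?_
    simp only [hb]
    push_cast
    ring
  have hcont : Continuous fun r : ℝ =>
      ∑ i ∈ S, ∑ j ∈ S, ‖1 - r * (u i * conj (u j))‖ ^ (2 * s) := by
    refine continuous_finsetSum _ fun i _ => continuous_finsetSum _ fun j _ => ?_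
    exact Continuous.rpow_const (by fun_prop) fun _ => Or.inr (by linarith)
  have hlim := (hcont.tendsto 1).mono_left (nhdsWithin_le_nhds (s := Set.Iio 1))
  simp only [Complex.ofReal_one, one_mul] at hlim
  refine le_of_tendsto hlim ?_
  filter_upwards [Ioo_mem_nhdsLT (show (0 : ℝ) < 1 by norm_num)] with r hr
  exact key r hr.1.le hr.2

open Finset in
theorem sum_range_sum_range_sub (F : ℕ → ℝ) (N : ℕ) :
    ∑ i ∈ range N, ∑ j ∈ range i, F (i - j) = ∑ j ∈ Icc 1 N, ((N : ℝ) - j) * F j := by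
  induction N with
  | zero => simp
  | succ N ih =>
    have h : ∑ j ∈ range N, F (N - j) = ∑ j ∈ Icc 1 N, F j := by
      rw [← sum_range_reflect, range_eq_Ico, ← Finset.Ico_add_one_right_eq_Icc,
        ← sum_Ico_add' _ 0 N 1]
      refine sum_congr rfl fun j hj => ?_
      congr 1
      have := (mem_Ico.1 hj).2
      omega
    rw [sum_range_succ, ih, h, sum_Icc_succ_top (by omega), ← sum_add_distrib]
    push_cast
    rw [sub_self, zero_mul, add_zero]
    exact sum_congr rfl fun j _ => by ring

open Finset ComplexConjugate in
/-- With the weights `1 - j / N`, of total mass about `N / 2`, the mean value of `|1 - z ^ j| ^ t` is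
at most `1 + O(t ^ 2) + O(1 / N)`, uniformly in `z` on the unit circle. -/
theorem sum_weight_mul_norm_one_sub_pow_le {z : ℂ} (hz : ‖z‖ = 1) {t : ℝ} (h0 : 0 < t) (h2 : t ≤ 2)
    (N : ℕ) :
    ∑ j ∈ Icc 1 N, ((N : ℝ) - j) * ‖1 - z ^ j‖ ^ t ≤ (N : ℝ) ^ 2 * (1 / 2 + t ^ 2 / 4) := by
  have h := sum_norm_one_sub_rpow_le (range N) (fun i => z ^ i) (fun i _ => by simp [hz])
    (s := t / 2) (by linarith) (by linarith)
  have hzz : z * conj z = 1 := by rw [Complex.mul_conj', hz]; simp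
  rw [show 2 * (t / 2) = t by ring, card_range, sum_range_sum_range_of_symm] at h
  -- The diagonal vanishes because `0 ^ t = 0` for `t ≠ 0`.
  · have e1 : ∑ k ∈ range N, ‖1 - z ^ k * conj (z ^ k)‖ ^ t = 0 := by
      refine sum_eq_zero fun k _ => ?_
      rw [map_pow, ← mul_pow, hzz, one_pow, sub_self, norm_zero, Real.zero_rpow h0.ne']
    have e2 : ∑ k ∈ range N, ∑ l ∈ range k, ‖1 - z ^ k * conj (z ^ l)‖ ^ t
        = ∑ k ∈ range N, ∑ l ∈ range k, ‖1 - z ^ (k - l)‖ ^ t := by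
      refine sum_congr rfl fun k _ => sum_congr rfl fun l hl => ?_
      obtain ⟨m, rfl⟩ := Nat.exists_eq_add_of_le (mem_range.1 hl).le
      rw [Nat.add_sub_cancel_left, pow_add, map_pow, mul_right_comm, ← mul_pow, hzz, one_pow,
        one_mul]
    rw [e1, e2, sum_range_sum_range_sub (fun m => ‖1 - z ^ m‖ ^ t)] at h
    linarith
  · intro k l
    rw [← Complex.norm_conj]
    simp [mul_comm]

/-! ### Random subsets -/

open Finset in
/-- The expectation of `∏ j ∈ S, v j` over the random set `S ⊆ s` that contains each `j`
independently with probability `p j`. -/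
theorem sum_powerset_bernoulli_mul_prod {ι : Type*} [DecidableEq ι] (s : Finset ι) (p v : ι → ℝ) :
    ∑ S ∈ s.powerset, ((∏ j ∈ S, p j) * ∏ j ∈ s \ S, (1 - p j)) * ∏ j ∈ S, v j
      = ∏ j ∈ s, (1 + p j * (v j - 1)) := by
  have h := prod_add (fun j => p j * v j) (fun j => 1 - p j) s
  rw [prod_congr rfl fun j _ => show 1 + p j * (v j - 1) = p j * v j + (1 - p j) by ring, h]
  refine sum_congr rfl fun S _ => ?_
  rw [prod_mul_distrib]; ring

open Finset in
theorem sum_powerset_bernoulli_mul_prod_le {ι : Type*} [DecidableEq ι] (s : Finset ι) (p v : ι → ℝ)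
    (hp0 : ∀ j ∈ s, 0 ≤ p j) (hp1 : ∀ j ∈ s, p j ≤ 1) (hv : ∀ j ∈ s, 0 ≤ v j) :
    ∑ S ∈ s.powerset, ((∏ j ∈ S, p j) * ∏ j ∈ s \ S, (1 - p j)) * ∏ j ∈ S, v j
      ≤ Real.exp (∑ j ∈ s, p j * v j - ∑ j ∈ s, p j) := by
  rw [sum_powerset_bernoulli_mul_prod, ← sum_sub_distrib, Real.exp_sum]
  refine prod_le_prod (fun j hj => ?_) fun j _ => ?_
  · have := mul_nonneg (hp0 j hj) (hv j hj)
    have := hp1 j hj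
    linarith
  · have := Real.add_one_le_exp (p j * v j - p j)
    linarith

open Finset in
/-- A random variable takes a value not exceeding its mean. -/
theorem exists_subset_of_bernoulli {ι : Type*} [DecidableEq ι] (s : Finset ι) (p : ι → ℝ)
    (hp0 : ∀ j ∈ s, 0 ≤ p j) (hp1 : ∀ j ∈ s, p j ≤ 1) (f : Finset ι → ℝ) {A : ℝ}
    (hf : ∑ S ∈ s.powerset, ((∏ j ∈ S, p j) * ∏ j ∈ s \ S, (1 - p j)) * f S ≤ A) :
    ∃ S ⊆ s, f S ≤ A := by
  by_contra! hcon
  have hone := sum_powerset_bernoulli_mul_prod s p fun _ => 1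
  simp only [prod_const_one, mul_one, sub_self, mul_zero, add_zero] at hone
  have hw : ∀ S ∈ s.powerset, 0 ≤ (∏ j ∈ S, p j) * ∏ j ∈ s \ S, (1 - p j) := fun S hS =>
    mul_nonneg (prod_nonneg fun j hj => hp0 j (mem_powerset.1 hS hj))
      (prod_nonneg fun j hj => sub_nonneg.2 (hp1 j (mem_sdiff.1 hj).1))
  have hlt : ∑ S ∈ s.powerset, ((∏ j ∈ S, p j) * ∏ j ∈ s \ S, (1 - p j)) * A
      < ∑ S ∈ s.powerset, ((∏ j ∈ S, p j) * ∏ j ∈ s \ S, (1 - p j)) * f S := by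
    refine sum_lt_sum (fun S hS => mul_le_mul_of_nonneg_left
      (hcon S (mem_powerset.1 hS)).le (hw S hS)) ?_
    obtain ⟨S, hS, hpos⟩ := exists_lt_of_sum_lt (s := s.powerset) (f := fun _ => (0 : ℝ))
      (g := fun S => (∏ j ∈ S, p j) * ∏ j ∈ s \ S, (1 - p j)) (by rw [hone]; simp)
    exact ⟨S, hS, mul_lt_mul_of_pos_left (hcon S (mem_powerset.1 hS)) hpos⟩
  rw [← sum_mul, hone, one_mul] at hlt
  linarith

/-! ### From roots of unity to the unit circle -/

open Finset Polynomial in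
/-- A polynomial of degree `< M` bounded by `B` at the `M`-th roots of unity is bounded by `M * B` on
the unit circle: by Fourier inversion each of its `M` coefficients is at most `B`. -/
theorem norm_eval_le_of_forall_root_of_unity {M : ℕ} {ω : ℂ} (hω : IsPrimitiveRoot ω M)
    {P : ℂ[X]} (hP : P.natDegree < M) {B : ℝ} (hB : ∀ l < M, ‖P.eval (ω ^ l)‖ ≤ B)
    {z : ℂ} (hz : ‖z‖ = 1) : ‖P.eval z‖ ≤ M * B := by
  have hM : 0 < M := by omega
  have hMR : (0 : ℝ) < M := by exact_mod_cast hM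
  have hω0 : ω ≠ 0 := hω.ne_zero hM.ne'
  have hnorm : ‖ω‖ = 1 := hω.norm'_eq_one hM.ne'
  have hcoeff : ∀ k < M, (M : ℂ) * P.coeff k = ∑ l ∈ range M, P.eval (ω ^ l) * (ω⁻¹ ^ k) ^ l := by
    intro k hk
    have horth : ∀ m ∈ range M, ∑ l ∈ range M, (ω ^ m * ω⁻¹ ^ k) ^ l = if m = k then (M : ℂ) else 0 := by
      intro m hm
      split_ifs with h
      · subst h
        rw [← mul_pow, mul_inv_cancel₀ hω0]; simp
      · have hne : ω ^ m * ω⁻¹ ^ k ≠ 1 := by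
          intro h1
          rw [inv_pow, mul_inv_eq_one₀ (pow_ne_zero _ hω0)] at h1
          exact h (hω.pow_inj (mem_range.1 hm) hk h1)
        have hpow : (ω ^ m * ω⁻¹ ^ k) ^ M = 1 := by
          rw [mul_pow, ← pow_mul, ← pow_mul, mul_comm m, mul_comm k, pow_mul, pow_mul, inv_pow,
            hω.pow_eq_one]; simp
        rw [geom_sum_eq hne, hpow, sub_self, zero_div]
    calc (M : ℂ) * P.coeff k
        = ∑ m ∈ range M, P.coeff m * ∑ l ∈ range M, (ω ^ m * ω⁻¹ ^ k) ^ l := by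
          rw [sum_congr rfl fun m hm => by rw [horth m hm]]
          simp [hk, mul_comm]
      _ = ∑ l ∈ range M, P.eval (ω ^ l) * (ω⁻¹ ^ k) ^ l := by
          simp only [mul_sum]
          rw [sum_comm]
          refine sum_congr rfl fun l _ => ?_
          rw [eval_eq_sum_range' hP, sum_mul]
          refine sum_congr rfl fun m _ => ?_
          rw [mul_pow, ← pow_mul ω m, mul_comm m, pow_mul]; ring
  have hcB : ∀ k < M, ‖P.coeff k‖ ≤ B := by
    intro k hk
    have h1 : (M : ℝ) * ‖P.coeff k‖ ≤ M * B := by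
      calc (M : ℝ) * ‖P.coeff k‖ = ‖(M : ℂ) * P.coeff k‖ := by simp
        _ ≤ ∑ l ∈ range M, ‖P.eval (ω ^ l) * (ω⁻¹ ^ k) ^ l‖ := by
          rw [hcoeff k hk]; exact norm_sum_le _ _
        _ ≤ ∑ l ∈ range M, B := by
          refine sum_le_sum fun l hl => ?_
          simpa [hnorm] using hB l (mem_range.1 hl)
        _ = M * B := by simp
    exact le_of_mul_le_mul_left h1 hMR
  calc ‖P.eval z‖ ≤ ∑ k ∈ range M, ‖P.coeff k * z ^ k‖ := by
        rw [eval_eq_sum_range' hP]; exact norm_sum_le _ _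
    _ ≤ ∑ k ∈ range M, B := by
        refine sum_le_sum fun k hk => ?_
        simpa [hz] using hcB k (mem_range.1 hk)
    _ = M * B := by simp

open Finset Polynomial in
theorem prod_norm_one_sub_pow_le {N : ℕ} {S : Finset ℕ} (hS : S ⊆ Icc 1 N) {ω : ℂ}
    (hω : IsPrimitiveRoot ω (N ^ 2 + 1)) {B : ℝ}
    (hB : ∀ l < N ^ 2 + 1, ∏ j ∈ S, ‖1 - (ω ^ l) ^ j‖ ≤ B) {z : ℂ} (hz : ‖z‖ = 1) :
    ∏ j ∈ S, ‖1 - z ^ j‖ ≤ (N ^ 2 + 1) * B := by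
  set P : ℂ[X] := ∏ j ∈ S, (1 - X ^ j) with hPdef
  have heval : ∀ w : ℂ, ‖P.eval w‖ = ∏ j ∈ S, ‖1 - w ^ j‖ := by
    intro w
    simp [hPdef, eval_prod, norm_prod]
  have hdeg : P.natDegree < N ^ 2 + 1 := by
    refine Nat.lt_succ_of_le ?_
    calc P.natDegree ≤ ∑ j ∈ S, (1 - X ^ j : ℂ[X]).natDegree := natDegree_prod_le _ _
      _ ≤ ∑ j ∈ S, N := by
          refine sum_le_sum fun j hj => (natDegree_sub_le _ _).trans ?_
          simpa using (mem_Icc.1 (hS hj)).2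
      _ ≤ N ^ 2 := by
          have := card_le_card hS
          rw [Nat.card_Icc, Nat.add_sub_cancel] at this
          rw [sum_const, smul_eq_mul, sq]
          exact Nat.mul_le_mul_right _ this
  have := norm_eval_le_of_forall_root_of_unity hω hdeg (B := B) (fun l hl => by
    rw [heval]; exact hB l hl) hz
  rw [heval] at this
  exact_mod_cast this

/-! ### Existence of a good subset -/

open Finset in
theorem sum_Icc_one_sub_div (N : ℕ) (hN : 0 < N) :
    ∑ j ∈ Icc 1 N, (1 - (j : ℝ) / N) = ((N : ℝ) - 1) / 2 := by
  have hgauss : ∀ n : ℕ, ∑ j ∈ Icc 1 n, (j : ℝ) = n * (n + 1) / 2 := by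
    intro n
    induction n with
    | zero => simp
    | succ n ih => rw [sum_Icc_succ_top (by omega), ih]; push_cast; ring
  have : (N : ℝ) ≠ 0 := by exact_mod_cast hN.ne'
  rw [sum_sub_distrib, ← sum_div, hgauss]
  simp only [sum_const, Nat.card_Icc, Nat.add_sub_cancel, nsmul_eq_mul]
  field_simp
  ring

theorem exp_sub_one_sub_le {x : ℝ} (hx : |x| ≤ 1) : Real.exp x - 1 ≤ x + x ^ 2 := by
  have := abs_le.1 (Real.abs_exp_sub_one_sub_id_le hx)
  linarith [this.2]

open Finset in
/-- For each `t` there is a set with about `N / 2` elements whose product is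
`exp (O(log N / t + N * t))` on the whole unit circle. Its existence is shown by averaging the sum of
the `t`-th powers of the products at the roots of unity of order `N ^ 2 + 1`, together with two
exponential moments that control the size of the set. -/
theorem exists_subset_prod_norm_one_sub_pow_le {N : ℕ} (hN : 0 < N) {t : ℝ} (ht0 : 0 < t)
    (ht2 : t ≤ 2) :
    ∃ S ⊆ Icc 1 N, |(S.card : ℝ) - (N - 1) / 2| ≤ 3 * √N ∧ ∀ z : ℂ, ‖z‖ = 1 →
      ∏ j ∈ S, ‖1 - z ^ j‖
        ≤ (N ^ 2 + 1) * (3 * ((N ^ 2 + 1) * Real.exp (N * t ^ 2 / 4 + 1 / 2))) ^ (1 / t) := by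
  have hNR : (0 : ℝ) < N := by exact_mod_cast hN
  have hN1 : (1 : ℝ) ≤ N := by exact_mod_cast hN
  obtain ⟨ω, hω⟩ : ∃ ω : ℂ, IsPrimitiveRoot ω (N ^ 2 + 1) :=
    ⟨_, Complex.isPrimitiveRoot_exp _ (by omega)⟩
  have hnorm : ‖ω‖ = 1 := hω.norm'_eq_one (by omega)
  set p : ℕ → ℝ := fun j => 1 - (j : ℝ) / N with hp
  have hp0 : ∀ j ∈ Icc 1 N, 0 ≤ p j := by
    intro j hj
    have : (j : ℝ) ≤ N := by exact_mod_cast (mem_Icc.1 hj).2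
    simp only [hp, sub_nonneg]
    rwa [div_le_one hNR]
  have hp1 : ∀ j ∈ Icc 1 N, p j ≤ 1 := by
    intro j _
    have : 0 ≤ (j : ℝ) / N := by positivity
    simp only [hp]; linarith
  have hpsum : ∑ j ∈ Icc 1 N, p j = ((N : ℝ) - 1) / 2 := sum_Icc_one_sub_div N hN
  set B : ℝ := (N ^ 2 + 1) * Real.exp (N * t ^ 2 / 4 + 1 / 2) with hB
  have hBpos : 0 < B := by positivity
  set W : Finset ℕ → ℝ := fun S => (∏ j ∈ S, p j) * ∏ j ∈ Icc 1 N \ S, (1 - p j) with hW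
  set X : Finset ℕ → ℝ := fun S =>
    ∑ l ∈ range (N ^ 2 + 1), ∏ j ∈ S, ‖1 - (ω ^ l) ^ j‖ ^ t with hX
  set Y : ℝ → Finset ℕ → ℝ := fun a S => ∏ j ∈ S, Real.exp a with hY
  have hEX : ∑ S ∈ (Icc 1 N).powerset, W S * X S ≤ B := by
    simp only [hX, mul_sum]
    rw [sum_comm]
    calc _ ≤ ∑ l ∈ range (N ^ 2 + 1), Real.exp (N * t ^ 2 / 4 + 1 / 2) := by
          refine sum_le_sum fun l _ => (sum_powerset_bernoulli_mul_prod_le _ p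
            (fun j => ‖1 - (ω ^ l) ^ j‖ ^ t) hp0 hp1 fun j _ => by positivity).trans ?_
          refine Real.exp_le_exp.2 ?_
          have h1 := sum_weight_mul_norm_one_sub_pow_le (z := ω ^ l) (by simp [hnorm]) ht0 ht2 N
          have h2 : ∑ j ∈ Icc 1 N, p j * ‖1 - (ω ^ l) ^ j‖ ^ t
              = (∑ j ∈ Icc 1 N, ((N : ℝ) - j) * ‖1 - (ω ^ l) ^ j‖ ^ t) / N := by
            rw [sum_div]
            refine sum_congr rfl fun j _ => ?_
            simp only [hp]; field_simp
          have h3 : (∑ j ∈ Icc 1 N, ((N : ℝ) - j) * ‖1 - (ω ^ l) ^ j‖ ^ t) / N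
              ≤ N * (1 / 2 + t ^ 2 / 4) := by
            rw [div_le_iff₀ hNR]; linarith
          rw [h2, hpsum]
          linarith
      _ = B := by simp [hB]
  have hEY : ∀ a : ℝ, |a| ≤ 1 → ∑ S ∈ (Icc 1 N).powerset, W S * Y a S
      ≤ Real.exp ((N - 1) / 2 * a + N * a ^ 2) := by
    intro a ha
    refine (sum_powerset_bernoulli_mul_prod_le _ p (fun _ => Real.exp a) hp0 hp1
      fun j _ => (Real.exp_pos a).le).trans (Real.exp_le_exp.2 ?_)
    rw [← sum_mul, hpsum]
    have h1 := mul_le_mul_of_nonneg_left (exp_sub_one_sub_le ha)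
      (show (0 : ℝ) ≤ (N - 1) / 2 by linarith)
    nlinarith [sq_nonneg a]
  -- The scale of the standard deviation of the size; both exponential moments are then at most
  -- `exp 1` after centring.
  set lam : ℝ := 1 / √N with hlam
  have hsq : 0 < √(N : ℝ) := Real.sqrt_pos.2 hNR
  have hlam1 : |lam| ≤ 1 := by
    rw [hlam, abs_of_pos (by positivity), div_le_one hsq]
    exact Real.one_le_sqrt.2 hN1
  have hlam2 : N * lam ^ 2 = 1 := by
    rw [hlam, div_pow, Real.sq_sqrt hNR.le]; field_simp
  have hEY1 := hEY lam hlam1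
  have hEY2 := hEY (-lam) (by rwa [abs_neg])
  rw [neg_sq] at hEY2
  rw [hlam2] at hEY1 hEY2
  -- Each of the three terms has mean at most `1`, so some `S` makes their sum at most `3`.
  obtain ⟨S, hS, hSf⟩ := exists_subset_of_bernoulli (Icc 1 N) p hp0 hp1
    (fun S => X S / B + Y lam S / Real.exp ((N - 1) / 2 * lam + 1)
      + Y (-lam) S / Real.exp ((N - 1) / 2 * (-lam) + 1)) (A := 3) (by
    have : ∀ S, W S * (X S / B + Y lam S / Real.exp ((N - 1) / 2 * lam + 1)
      + Y (-lam) S / Real.exp ((N - 1) / 2 * (-lam) + 1)) = W S * X S / B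
        + W S * Y lam S / Real.exp ((N - 1) / 2 * lam + 1)
        + W S * Y (-lam) S / Real.exp ((N - 1) / 2 * (-lam) + 1) := fun S => by ring
    change ∑ S ∈ (Icc 1 N).powerset, W S * _ ≤ 3
    simp only [this, sum_add_distrib, ← sum_div]
    have e1 := (div_le_one hBpos).2 hEX
    have e2 := (div_le_one (Real.exp_pos _)).2 hEY1
    have e3 := (div_le_one (Real.exp_pos _)).2 hEY2
    linarith)
  have hX0 : 0 ≤ X S := sum_nonneg fun l _ => prod_nonneg fun j _ => by positivity
  have hYe : ∀ a, Y a S = Real.exp (S.card * a) := fun a => by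
    simp only [hY, prod_const]; rw [← Real.exp_nat_mul]
  have hdev : ∀ a : ℝ, Y a S / Real.exp ((N - 1) / 2 * a + 1) ≤ 3 →
      (S.card - (N - 1) / 2) * a ≤ 3 := by
    intro a ha
    rw [hYe, ← Real.exp_sub] at ha
    have := Real.add_one_le_exp (S.card * a - ((N - 1) / 2 * a + 1))
    linarith
  have hX1 : 0 ≤ X S / B := by positivity
  have hY1 : ∀ a c : ℝ, 0 ≤ Y a S / Real.exp c := fun a c => by rw [hYe]; positivity
  have hd1 := hdev lam (by linarith [hY1 (-lam) ((N - 1) / 2 * (-lam) + 1)])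
  have hd2 := hdev (-lam) (by linarith [hY1 lam ((N - 1) / 2 * lam + 1)])
  have hXB : X S ≤ 3 * B := by
    rw [← div_le_iff₀ hBpos]
    linarith [hY1 (-lam) ((N - 1) / 2 * (-lam) + 1), hY1 lam ((N - 1) / 2 * lam + 1)]
  -- The product over `S` has degree at most `N ^ 2` in `z`.
  refine ⟨S, hS, ?_, fun z hz => prod_norm_one_sub_pow_le hS hω (fun l hl => ?_) hz⟩
  · rw [hlam, mul_one_div, div_le_iff₀ hsq] at hd1
    rw [hlam, mul_neg, mul_one_div, ← neg_div, div_le_iff₀ hsq] at hd2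
    rw [abs_le]
    constructor <;> linarith
  · have h1 : (∏ j ∈ S, ‖1 - (ω ^ l) ^ j‖) ^ t ≤ 3 * B := by
      rw [← Real.finsetProd_rpow _ _ fun j _ => norm_nonneg _]
      exact (single_le_sum (f := fun l => ∏ j ∈ S, ‖1 - (ω ^ l) ^ j‖ ^ t)
        (fun l _ => prod_nonneg fun j _ => by positivity) (mem_range.2 hl)).trans hXB
    have h2 := Real.rpow_le_rpow (by positivity) h1 (show 0 ≤ 1 / t by positivity)
    rwa [← Real.rpow_mul (prod_nonneg fun j _ => norm_nonneg _), mul_one_div_cancel ht0.ne',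
      Real.rpow_one] at h2

/-! ### Choice of the parameter -/

theorem circleMax_orderEmbOfFin_le (S : Finset ℕ) {B : ℝ}
    (hB : ∀ z : ℂ, ‖z‖ = 1 → ∏ j ∈ S, ‖1 - z ^ j‖ ≤ B) :
    circleMax (S.orderEmbOfFin rfl) ≤ B := by
  refine ciSup_le fun z => ?_
  have h : ∏ i, ‖1 - (z : ℂ) ^ S.orderEmbOfFin rfl i‖ = ∏ j ∈ S, ‖1 - (z : ℂ) ^ j‖ := by
    conv_rhs => rw [← Finset.map_orderEmbOfFin_univ S rfl, Finset.prod_map]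
    rfl
  rw [h]
  exact hB z z.norm_coe

open Real in
/-- The choice `t = √(log N / N)` balances `log N / t` against `N * t`. -/
theorem bound_le_exp_sqrt_mul_log {N : ℕ} (hN : 3 ≤ N) {t : ℝ} (ht : t = √(log N / N)) :
    ((N : ℝ) ^ 2 + 1) * (3 * ((N ^ 2 + 1) * exp (N * t ^ 2 / 4 + 1 / 2))) ^ (1 / t)
      ≤ exp (9 * (√N * √(log N))) := by
  have hN3 : (3 : ℝ) ≤ N := by exact_mod_cast hN
  have hN0 : (0 : ℝ) < N := by linarith
  have hlog1 : 1 ≤ log N := by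
    rw [le_log_iff_exp_le hN0]
    linarith [exp_one_lt_three]
  have hlogN : log N ≤ N := (log_le_sub_one_of_pos hN0).trans (by linarith)
  have ht0 : 0 < t := by rw [ht]; exact sqrt_pos.2 (by positivity)
  have hNt : N * t ^ 2 = log N := by
    rw [ht, sq_sqrt (by positivity)]; field_simp
  have h1 : (N : ℝ) ^ 2 + 1 ≤ exp (3 * log N) := by
    rw [show (3 : ℝ) * log N = (3 : ℕ) * log N by norm_num, exp_nat_mul, exp_log hN0]
    nlinarith
  have h3 : (3 : ℝ) ≤ exp (log N) := by rwa [exp_log hN0]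
  have h2 : 3 * (((N : ℝ) ^ 2 + 1) * exp (N * t ^ 2 / 4 + 1 / 2)) ≤ exp (6 * log N) := by
    calc 3 * (((N : ℝ) ^ 2 + 1) * exp (N * t ^ 2 / 4 + 1 / 2))
        ≤ exp (log N) * (exp (3 * log N) * exp (N * t ^ 2 / 4 + 1 / 2)) := by gcongr
      _ = exp (log N + (3 * log N + (N * t ^ 2 / 4 + 1 / 2))) := by
          rw [exp_add (log N), exp_add (3 * log N)]
      _ ≤ exp (6 * log N) := exp_le_exp.2 (by rw [hNt]; linarith)
  have hLt : log N * (1 / t) = √N * √(log N) := by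
    rw [mul_one_div, div_eq_iff ht0.ne', ht, sqrt_div (by linarith)]
    have hs : √(N : ℝ) ≠ 0 := (sqrt_pos.2 hN0).ne'
    field_simp
    rw [sq_sqrt (by linarith)]
  have hL : log N ≤ √N * √(log N) := by
    calc log N = √(log N) * √(log N) := (mul_self_sqrt (by linarith)).symm
      _ ≤ √N * √(log N) := by gcongr
  calc _ ≤ exp (3 * log N) * exp (6 * log N) ^ (1 / t) := by gcongr
    _ = exp (3 * log N + 6 * (√N * √(log N))) := by
      rw [← exp_mul, ← exp_add, mul_assoc, hLt]
    _ ≤ _ := exp_le_exp.2 (by linarith)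

open Real in
theorem sqrt_mul_sqrt_log_lt {N n : ℕ} (hn : 100 ≤ n) (hNn : N ≤ 4 * n) (hN : 1 ≤ N) :
    9 * (√N * √(log N)) < 28 * √n * √(log n) * log (log n) := by
  have hn' : (100 : ℝ) ≤ n := by exact_mod_cast hn
  have hNn' : (N : ℝ) ≤ 4 * n := by exact_mod_cast hNn
  have hN0 : (0 : ℝ) < N := by exact_mod_cast hN
  have hlog3 : 3 ≤ log n := by
    rw [le_log_iff_exp_le (by linarith), show (3 : ℝ) = (3 : ℕ) * 1 by norm_num, exp_nat_mul]
    have h27 : exp 1 ^ 3 ≤ (3 : ℝ) ^ 3 :=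
      pow_le_pow_left₀ (exp_pos 1).le exp_one_lt_three.le 3
    linarith
  have hll : 1 ≤ log (log n) := by
    rw [le_log_iff_exp_le (by linarith)]
    linarith [exp_one_lt_three]
  have hlogN : log N ≤ 2 * log n := by
    rw [show 2 * log n = log ((n : ℝ) ^ 2) by rw [log_pow]; norm_num]
    exact log_le_log hN0 (by nlinarith)
  have h1 : √N * √(log N) ≤ 3 * (√n * √(log n)) := by
    rw [← sqrt_mul hN0.le, ← sqrt_mul (by linarith), sqrt_le_left (by positivity), mul_pow,
      sq_sqrt (by nlinarith)]
    have hlog0 : 0 ≤ log N := log_nonneg (by exact_mod_cast hN)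
    nlinarith [mul_le_mul hNn' hlogN hlog0 (by linarith)]
  have hpos : 0 < √n * √(log n) := mul_pos (sqrt_pos.2 (by linarith)) (sqrt_pos.2 (by linarith))
  nlinarith [mul_le_mul_of_nonneg_left hll hpos.le]

theorem proposition1p1 :
    ∃ c : ℝ, 0 < c ∧
      ∀ ε : ℝ, 0 < ε →
        ∃ N₀ : ℕ, ∀ N : ℕ, N₀ ≤ N →
          ∃ (n : ℕ) (a : Fin n → ℕ),
            StrictMono a ∧ (∀ i, 1 ≤ a i ∧ a i ≤ N) ∧
            |(n : ℝ) - (N : ℝ) / 2| ≤ ε * (N : ℝ) ∧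
            circleMax a <
              Real.exp (c * √(n : ℝ) * √(Real.log (n : ℝ)) * Real.log (Real.log (n : ℝ))) := by
  refine ⟨28, by norm_num, fun ε hε => ⟨max 400 ⌈(4 / ε) ^ 2⌉₊, fun N hN => ?_⟩⟩
  have hN400 : 400 ≤ N := (le_max_left _ _).trans hN
  have hNε : (4 / ε) ^ 2 ≤ N := Nat.ceil_le.1 ((le_max_right _ _).trans hN)
  have hNR : (400 : ℝ) ≤ N := by exact_mod_cast hN400
  have hsq : √(N : ℝ) * √N = N := Real.mul_self_sqrt (by linarith)
  have hs20 : 20 ≤ √(N : ℝ) := Real.le_sqrt_of_sq_le (by linarith)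
  have hsε : 4 / ε ≤ √(N : ℝ) := Real.le_sqrt_of_sq_le hNε
  have hlog0 : 0 < Real.log N := Real.log_pos (by linarith)
  have hlogN : Real.log N ≤ N := (Real.log_le_sub_one_of_pos (by linarith)).trans (by linarith)
  have ht2 : √(Real.log N / N) ≤ 2 := by
    refine Real.sqrt_le_iff.2 ⟨by norm_num, ?_⟩
    rw [div_le_iff₀ (by linarith)]
    linarith
  obtain ⟨S, hS, hcard, hprod⟩ := exists_subset_prod_norm_one_sub_pow_le (N := N) (by omega)
    (Real.sqrt_pos.2 (div_pos hlog0 (by linarith))) ht2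
  obtain ⟨hc1, hc2⟩ := abs_le.1 hcard
  have hn : (N : ℝ) ≤ 4 * S.card := by nlinarith
  have hn' : N ≤ 4 * S.card := by exact_mod_cast hn
  refine ⟨S.card, S.orderEmbOfFin rfl, (S.orderEmbOfFin rfl).strictMono,
    fun i => Finset.mem_Icc.1 (hS (S.orderEmbOfFin_mem rfl i)), ?_, ?_⟩
  · have h4 : 4 * √(N : ℝ) ≤ ε * N := by
      rw [div_le_iff₀ hε] at hsε
      nlinarith
    rw [abs_le]
    constructor <;> linarith
  · calc circleMax (S.orderEmbOfFin rfl) ≤ Real.exp (9 * (√N * √(Real.log N))) :=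
          circleMax_orderEmbOfFin_le S fun z hz =>
            (hprod z hz).trans (bound_le_exp_sqrt_mul_log (by omega) rfl)
      _ < _ := Real.exp_lt_exp.2 (sqrt_mul_sqrt_log_lt (by omega) hn' (by omega))
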